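/- Let $\bigtriangledown$ be the closed downward equilateral triangle with barycenter at the origin and one vertex on the negative $y$-axis; its homothets are the sets $b+\mu\bigtriangledown$ with $b\in\mathbb R^2$ and $\mu\ge 0$. For points $p,q$ of the plane let $t(p,q)$ be the smallest homothet of $\bigtriangledown$ having both $p$ and $q$ on its boundary. For a finite point set $P\subset\mathbb R^2$ and an integer $k\ge 0$, the order-$k$ TD-Delaunay graph $k\text{-TD}(P)$ has vertex set $P$, and two distinct points $p,q\in P$ are adjacent iff the interior of $t(p,q)$ contains at most $k$ points of $P$. The weight of a pair $(p,q)$ is the area of $t(p,q)$. A bottleneck Hamiltonian cycle of $P$ is a Hamiltonian cycle of the complete graph on $P$ whose maximum edge weight is minimum among all Hamiltonian cycles of the complete graph on $P$. **Theorem.** 1. For every finite set $P\subset\mathbb R^2$ with $|P|\ge 3$, some bottleneck Hamiltonian cycle of $P$ has all its edges in $7\text{-TD}(P)$. 2. Consequently, for every finite set $P\subset\mathbb R^2$ with $|P|\ge 3$, the graph $7\text{-TD}(P)$ is Hamiltonian. 3. There is a set $P\subset\mathbb R^2$ of $17$ points such that no bottleneck Hamiltonian cycle of $P$ has all its edges in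 $5\text{-TD}(P)$. -/

import Mathlib

namespace TDDelaunay

/-- The Euclidean plane. -/
abbrev Plane : Type := EuclideanSpace ℝ (Fin 2)

/-- The downward equilateral triangle `▽` (closed region) whose barycenter is the origin and
which has a vertex on the negative `y`-axis. -/
noncomputable def downTriangle : Set Plane :=
  convexHull ℝ {!₂[0, -1], !₂[√3 / 2, 1 / 2], !₂[-(√3 / 2), 1 / 2]}

/-- The homothet `b + μ ▽`. -/
noncomputable def homothet (b : Plane) (μ : ℝ) : Set Plane :=
  (fun a : Plane => b + μ • a) '' downTriangle

/-- `S` is a smallest homothet of `▽` (scaling factor `≥ 0`) having `p` and `q` on its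
boundary. -/
def IsSmallestHomothet (p q : Plane) (S : Set Plane) : Prop :=
  ∃ (b : Plane) (μ : ℝ), 0 ≤ μ ∧ S = homothet b μ ∧ p ∈ frontier S ∧ q ∈ frontier S ∧
    ∀ (b' : Plane) (μ' : ℝ), 0 ≤ μ' → p ∈ frontier (homothet b' μ') →
      q ∈ frontier (homothet b' μ') → μ ≤ μ'

/-! The smallest homothet exists and is unique; this is proved through the description of the
triangle by its three sides. -/

/-- The three outward unit normals of the sides of `▽`, as linear functionals. -/
noncomputable def side : Fin 3 → Plane →L[ℝ] ℝ :=
  ![EuclideanSpace.proj 1,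
    (√3 / 2) • EuclideanSpace.proj 0 - (1 / 2 : ℝ) • EuclideanSpace.proj 1,
    -((√3 / 2) • EuclideanSpace.proj 0) - (1 / 2 : ℝ) • EuclideanSpace.proj 1]

theorem side_zero (x : Plane) : side 0 x = x 1 := by simp [side]

theorem side_one (x : Plane) : side 1 x = √3 / 2 * x 0 - 1 / 2 * x 1 := by simp [side]

theorem side_two (x : Plane) : side 2 x = -(√3 / 2 * x 0) - 1 / 2 * x 1 := by simp [side]

theorem side_sum (x : Plane) : side 0 x + side 1 x + side 2 x = 0 := by
  rw [side_zero, side_one, side_two]; ring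

theorem side_surjective (i : Fin 3) : Function.Surjective (side i) := by
  intro c
  fin_cases i
  · exact ⟨!₂[0, c], by simp [side]⟩
  · exact ⟨!₂[0, -2 * c], by simp [side]⟩
  · exact ⟨!₂[0, -2 * c], by simp [side]⟩

theorem mem_downTriangle (x : Plane) : x ∈ downTriangle ↔ ∀ i, side i x ≤ 1 / 2 := by
  have h3 : √3 * √3 = 3 := Real.mul_self_sqrt (by norm_num)
  rw [downTriangle, convexHull_insert (by simp), convexHull_pair, Fin.forall_fin_succ,
    Fin.forall_fin_two]
  change _ ↔ side 0 x ≤ _ ∧ side 1 x ≤ _ ∧ side 2 x ≤ _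
  rw [side_zero, side_one, side_two]
  simp only [convexJoin_singleton_left, Set.mem_iUnion, exists_prop]
  constructor
  · rintro ⟨y, ⟨s, t, hs, ht, hst, rfl⟩, u, v, hu, hv, huv, rfl⟩
    have e : s = 1 - t := by linarith
    have e' : u = 1 - v := by linarith
    subst e e'
    simp
    refine ⟨?_, ?_, ?_⟩ <;> nlinarith [mul_nonneg hv ht, mul_nonneg hv hs]
  · rintro ⟨h0, h1, h2⟩
    have h3' : 0 < √3 := by positivity
    rcases eq_or_ne (x 1) (-1) with h | h
    · have hx : x 0 = 0 := by rw [h] at h1 h2; nlinarith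
      refine ⟨_, left_mem_segment ℝ _ _, 1, 0, by simp, by simp, by simp, ?_⟩
      ext i; fin_cases i <;> simp [h, hx]
    · have hp : 0 < 1 + x 1 := lt_of_le_of_ne (by nlinarith) (fun e => h (by linarith))
      refine ⟨!₂[3 / 2 * x 0 / (1 + x 1), 1 / 2],
        ⟨1 / 2 + √3 / 2 * x 0 / (1 + x 1), 1 / 2 - √3 / 2 * x 0 / (1 + x 1), ?_, ?_,
          by ring, ?_⟩,
        1 - 2 / 3 * (1 + x 1), 2 / 3 * (1 + x 1), by linarith, by linarith, by ring, ?_⟩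
      · have : -(1 / 2) ≤ √3 / 2 * x 0 / (1 + x 1) := by rw [le_div_iff₀ hp]; linarith
        linarith
      · have : √3 / 2 * x 0 / (1 + x 1) ≤ 1 / 2 := by rw [div_le_iff₀ hp]; linarith
        linarith
      · ext i
        fin_cases i
        · simp
          field_simp
          linear_combination 2 * x 0 * h3
        · simp
          ring
      · ext i
        fin_cases i
        · simp
          field_simp
        · simp
          ring

theorem eq_of_side_le {x y : Plane} (h : ∀ i, side i x ≤ side i y) : x = y := by
  have h3 : 0 < √3 := by positivity
  have h0 := h 0
  have h1 := h 1
  have h2 := h 2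
  have hx := side_sum x
  have hy := side_sum y
  have e0 : side 0 x = side 0 y := by linarith
  have e1 : side 1 x = side 1 y := by linarith
  rw [side_zero, side_zero] at e0
  rw [side_one, side_one, e0] at e1
  have e : √3 / 2 * (x 0 - y 0) = 0 := by linarith
  have e' : x 0 - y 0 = 0 := by
    rcases mul_eq_zero.1 e with h | h
    · linarith
    · exact h
  ext i
  fin_cases i
  · exact sub_eq_zero.1 e'
  · exact e0

theorem mem_homothet {b : Plane} {μ : ℝ} (hμ : 0 ≤ μ) (x : Plane) :
    x ∈ homothet b μ ↔ ∀ i, side i x ≤ side i b + μ / 2 := by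
  rcases hμ.eq_or_lt with rfl | hpos
  · constructor
    · rintro ⟨a, -, rfl⟩ i
      simp
    · intro h
      have hx : x = b := eq_of_side_le fun i => by simpa using h i
      refine ⟨0, (mem_downTriangle 0).2 fun i => by simp, by simp [hx]⟩
  · constructor
    · rintro ⟨a, ha, rfl⟩ i
      have := mul_le_mul_of_nonneg_left ((mem_downTriangle a).1 ha i) hμ
      simp only [map_add, map_smul, smul_eq_mul]
      linarith
    · intro h
      refine ⟨μ⁻¹ • (x - b), (mem_downTriangle _).2 fun i => ?_, ?_⟩
      · simp only [map_sub, map_smul, smul_eq_mul]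
        rw [inv_mul_le_iff₀ hpos]
        linarith [h i]
      · simp [smul_smul, hpos.ne']

theorem homothet_eq {b : Plane} {μ : ℝ} (hμ : 0 ≤ μ) :
    homothet b μ = ⋂ i, side i ⁻¹' Set.Iic (side i b + μ / 2) := by
  ext x; simp [mem_homothet hμ]

theorem interior_homothet {b : Plane} {μ : ℝ} (hμ : 0 ≤ μ) :
    interior (homothet b μ) = {x | ∀ i, side i x < side i b + μ / 2} := by
  rw [homothet_eq hμ, interior_iInter_of_finite]
  ext x
  simp [(side _).interior_preimage (side_surjective _)]

theorem isClosed_homothet {b : Plane} {μ : ℝ} (hμ : 0 ≤ μ) : IsClosed (homothet b μ) := by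
  rw [homothet_eq hμ]
  exact isClosed_iInter fun i => isClosed_Iic.preimage (side i).continuous

theorem mem_frontier_homothet {b : Plane} {μ : ℝ} (hμ : 0 ≤ μ) (x : Plane) :
    x ∈ frontier (homothet b μ) ↔
      (∀ i, side i x ≤ side i b + μ / 2) ∧ ∃ i, side i x = side i b + μ / 2 := by
  rw [(isClosed_homothet hμ).frontier_eq, interior_homothet hμ, Set.mem_sdiff, mem_homothet hμ]
  simp only [Set.mem_ofPred_eq, not_forall, not_lt]
  exact and_congr_right fun h => exists_congr fun i => ⟨fun h' => le_antisymm (h i) h', ge_of_eq⟩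

theorem existsUnique_isSmallestHomothet (p q : Plane) : ∃! S, IsSmallestHomothet p q S := by
  have h3 : √3 * √3 = 3 := Real.mul_self_sqrt (by norm_num)
  have hp := side_sum p
  have hq := side_sum q
  set c : Fin 3 → ℝ := fun i => max (side i p) (side i q) with hc
  have hcp : ∀ i, side i p ≤ c i := fun i => le_max_left _ _
  have hcq : ∀ i, side i q ≤ c i := fun i => le_max_right _ _
  have hcc : ∀ i, c i = side i p ∨ c i = side i q := fun i => max_choice _ _
  set m : ℝ := 2 / 3 * (c 0 + c 1 + c 2) with hm
  have hm0 : 0 ≤ m := by linarith [hcp 0, hcp 1, hcp 2]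
  set b₀ : Plane := !₂[(c 1 - c 2) / √3, c 0 - m / 2] with hb₀
  have hs : ∀ i, side i b₀ + m / 2 = c i := by
    have e : √3 / 2 * ((c 1 - c 2) / √3) = (c 1 - c 2) / 2 := by
      have : √3 ≠ 0 := by positivity
      field_simp
    intro i
    fin_cases i
    · change side 0 b₀ + m / 2 = c 0
      rw [side_zero]; simp [hb₀]
    · change side 1 b₀ + m / 2 = c 1
      rw [side_one]; simp only [hb₀, PiLp.toLp_apply, Matrix.cons_val_zero, Matrix.cons_val_one]
      rw [e]; linarith
    · change side 2 b₀ + m / 2 = c 2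
      rw [side_two]; simp only [hb₀, PiLp.toLp_apply, Matrix.cons_val_zero, Matrix.cons_val_one]
      rw [e]; linarith
  have key : ∀ (b : Plane) (μ : ℝ), 0 ≤ μ → p ∈ frontier (homothet b μ) →
      q ∈ frontier (homothet b μ) → ∀ i, c i ≤ side i b + μ / 2 := fun b μ h hpf hqf i =>
    max_le (((mem_frontier_homothet h p).1 hpf).1 i) (((mem_frontier_homothet h q).1 hqf).1 i)
  have hpf : p ∈ frontier (homothet b₀ m) := by
    refine (mem_frontier_homothet hm0 p).2 ⟨fun i => (hs i).symm ▸ hcp i, ?_⟩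
    by_contra! hne
    have hlt : ∀ i, side i p < side i q := fun i => by
      rcases hcc i with h | h
      · exact absurd (h.symm.trans (hs i).symm) (hne i)
      · exact lt_of_le_of_ne (h ▸ hcp i) fun e => hne i (by rw [hs, h, e])
    linarith [hlt 0, hlt 1, hlt 2]
  have hqf : q ∈ frontier (homothet b₀ m) := by
    refine (mem_frontier_homothet hm0 q).2 ⟨fun i => (hs i).symm ▸ hcq i, ?_⟩
    by_contra! hne
    have hlt : ∀ i, side i q < side i p := fun i => by
      rcases hcc i with h | h
      · exact lt_of_le_of_ne (h ▸ hcq i) fun e => hne i (by rw [hs, h, e])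
      · exact absurd (h.symm.trans (hs i).symm) (hne i)
    linarith [hlt 0, hlt 1, hlt 2]
  refine ⟨homothet b₀ m, ⟨b₀, m, hm0, rfl, hpf, hqf, fun b μ h hp' hq' => ?_⟩, ?_⟩
  · have := key b μ h hp' hq'
    linarith [this 0, this 1, this 2, side_sum b]
  · rintro _ ⟨b, μ, h, rfl, hp', hq', hmin⟩
    have hle : μ ≤ m := hmin b₀ m hm0 hpf hqf
    have := key b μ h hp' hq'
    have e : μ = m := le_antisymm hle (by linarith [this 0, this 1, this 2, side_sum b])
    subst e
    have hb : b₀ = b := eq_of_side_le fun i => by linarith [this i, hs i]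
    rw [hb]

/-- `t(p, q)`: the smallest homothet of `▽` having `p` and `q` on its boundary. -/
noncomputable def t (p q : Plane) : Set Plane :=
  (existsUnique_isSmallestHomothet p q).choose

theorem isSmallestHomothet_t (p q : Plane) : IsSmallestHomothet p q (t p q) :=
  (existsUnique_isSmallestHomothet p q).choose_spec.1

theorem t_comm (p q : Plane) : t p q = t q p := by
  refine (existsUnique_isSmallestHomothet p q).unique (isSmallestHomothet_t p q) ?_
  obtain ⟨b, μ, h0, hS, hq, hp, hmin⟩ := isSmallestHomothet_t q p
  exact ⟨b, μ, h0, hS, hp, hq, fun b' μ' h hp' hq' => hmin b' μ' h hq' hp'⟩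

/-- The order-`k` TD-Delaunay graph of `P`: distinct points `p`, `q` of `P` are adjacent iff the
interior of `t(p, q)` contains at most `k` points of `P`. -/
noncomputable def kTD (k : ℕ) (P : Finset Plane) : SimpleGraph P where
  Adj p q := p ≠ q ∧ ((P : Set Plane) ∩ interior (t p q)).ncard ≤ k
  symm := ⟨fun p q h => ⟨h.1.symm, by rw [t_comm]; exact h.2⟩⟩
  loopless := ⟨fun p h => h.1 rfl⟩

/-- The weight of the edge `(p, q)`: the area of `t(p, q)`. -/
noncomputable def weight (p q : Plane) : ENNReal := MeasureTheory.volume (t p q)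

/-- The bottleneck `λ(c)` of a closed walk `c`: the largest weight of an edge of `c`. -/
noncomputable def bottleneck {P : Finset Plane} {G : SimpleGraph P} {v : P} (c : G.Walk v v) :
    ENNReal :=
  ⨆ d ∈ c.darts, weight d.fst d.snd

/-- A bottleneck Hamiltonian cycle of `G`: a Hamiltonian cycle of `G` whose largest edge weight is
minimum among all Hamiltonian cycles of `G`. -/
def IsBottleneckHamiltonianCycle {P : Finset Plane} {G : SimpleGraph P} {v : P}
    (c : G.Walk v v) : Prop :=
  c.IsHamiltonianCycle ∧
    ∀ (w : P) (c' : G.Walk w w), c'.IsHamiltonianCycle → bottleneck c ≤ bottleneck c'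

/-- `G` contains a bottleneck Hamiltonian cycle of `P`, i.e. a bottleneck Hamiltonian cycle of the
complete graph on `P` all of whose edges are edges of `G`. -/
def ContainsBottleneckHamiltonianCycle {P : Finset Plane} (G : SimpleGraph P) : Prop :=
  ∃ (v : P) (c : (⊤ : SimpleGraph P).Walk v v),
    IsBottleneckHamiltonianCycle c ∧ ∀ e ∈ c.edges, e ∈ G.edgeSet

end TDDelaunay

/-! Give each pair the cost `K ^ r`, where `r` counts the ordered pairs of smaller weight and `K`
exceeds the number of points. The longest edge then dominates the cost of a cycle, so a Hamiltonian
cycle of minimum total cost is a bottleneck cycle (`exists_dart_le`), and no exchange of two or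
three edges replaces the longest removed edge by shorter ones only.

Let `(a, b)` be an edge of such a cycle, traverse the cycle from `b` to `a`, and let each point `u`
inside `t(a, b)` have predecessor `s`. Since `u` is closer to `a` and to `b` than these are to each
other, the exchanges force `s` to be far from `a` and any two such predecessors to be far from each
other (`IsOptTour.le_of_pred`, `IsOptTour.le_of_pred_pred`). The weight is monotone in a distance
with hexagonal unit ball. In that distance the outside of the hexagon around `a` splits into seven
regions, none of which contains two predecessors (`region_ne`), so at most seven points lie inside
`t(a, b)`.

For the lower bound, 17 explicit lattice points have a Hamiltonian cycle with longest distance 100.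
Nine of them are pairwise farther apart than 100, except for one pair whose triangle contains six
further points. A bottleneck cycle inside `5-TD` would have no edge between two of the nine,
impossible on a 17-cycle. -/

namespace TDDelaunay

open MeasureTheory
open scoped Pointwise

/-! ### Minimum-cost tours and their exchange inequalities. -/

section Tours

variable {V : Type*}

theorem getLast?_append_of {X Y : List V} {a : V} (h : Y.getLast? = some a) :
    (X ++ Y).getLast? = some a := by
  rw [List.getLast?_append, h]; rfl

/-- The sum of `f` over the consecutive pairs of a list. -/
def pathSum (f : V → V → ℕ) : List V → ℕ
  | [] => 0
  | [_] => 0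
  | x :: y :: l => f x y + pathSum f (y :: l)

theorem pathSum_append (f : V → V → ℕ) {s u : V} :
    ∀ {X Y : List V}, X.getLast? = some s → Y.head? = some u →
      pathSum f (X ++ Y) = pathSum f X + f s u + pathSum f Y
  | [], _, h, _ => by simp at h
  | [x], [], _, h => by simp at h
  | [x], y :: Y, h, h' => by
    simp only [List.getLast?_singleton, List.head?_cons, Option.some.injEq] at h h'
    subst h h'
    simp [pathSum]
  | x :: x' :: X, Y, h, h' => by
    have := pathSum_append f (X := x' :: X) (Y := Y) (s := s) (by simpa using h) h'
    simp only [List.cons_append, pathSum] at this ⊢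
    rw [this]; ring

theorem pathSum_reverse {f : V → V → ℕ} (hf : ∀ x y, f x y = f y x) :
    ∀ X : List V, pathSum f X.reverse = pathSum f X
  | [] => rfl
  | [_] => rfl
  | x :: y :: X => by
    rw [List.reverse_cons, pathSum_append f (s := y) (u := x) (by simp) (by simp),
      pathSum_reverse hf, hf]
    simp [pathSum]; ring

/-- `T` lists all points of `V` once, starting with `b` and ending with `a`. -/
structure IsTour (a b : V) (T : List V) : Prop where
  nodup : T.Nodup
  mem : ∀ v, v ∈ T
  head : T.head? = some b
  last : T.getLast? = some a

/-- A tour of minimum cost, the closing pair `(a, b)` included. -/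
structure IsOptTour (f : V → V → ℕ) (a b : V) (T : List V) : Prop extends IsTour a b T where
  le : ∀ a' b' T', IsTour a' b' T' → f a b + pathSum f T ≤ f a' b' + pathSum f T'

theorem IsTour.perm {a b a' b' : V} {T T' : List V} (h : IsTour a b T) (hp : T.Perm T')
    (hb : T'.head? = some b') (ha : T'.getLast? = some a') : IsTour a' b' T' :=
  ⟨hp.nodup h.nodup, fun v => hp.subset (h.mem v), hb, ha⟩

/-- Costs are natural numbers, so well-foundedness alone gives a minimum. -/
theorem exists_isOptTour (f : V → V → ℕ) {a b : V} {T : List V} (h : IsTour a b T) :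
    ∃ a b T, IsOptTour f a b T := by
  obtain ⟨⟨a, b, T⟩, hT, hmin⟩ := WellFounded.has_min
    (measure fun x : V × V × List V => f x.1 x.2.1 + pathSum f x.2.2).wf
    {x | IsTour x.1 x.2.1 x.2.2} ⟨(a, b, T), h⟩
  exact ⟨a, b, T, hT, fun a' b' T' h' => not_lt.1 (hmin (a', b', T') h')⟩

variable {f : V → V → ℕ} {a b : V} {T : List V}

theorem IsOptTour.reverse (hf : ∀ x y, f x y = f y x) (h : IsOptTour f a b T) :
    IsOptTour f b a T.reverse where
  toIsTour := h.toIsTour.perm (List.reverse_perm T).symm (by simp [h.last]) (by simp [h.head])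
  le a' b' T' h' := by
    rw [pathSum_reverse hf, hf]
    exact h.le a' b' T' h'

/-- Cyclic rotation keeps the total cost. This lets any edge of the cycle play the role of the
closing pair. -/
theorem IsOptTour.rotate {X Y : List V} {a' b' : V} (h : IsOptTour f a b T)
    (hT : T = X ++ a' :: b' :: Y) : ∃ T', IsOptTour f a' b' T' := by
  have hX : (X ++ [a']).head? = some b := by
    have := h.head
    rw [hT] at this
    cases X <;> simpa using this
  have hY : (b' :: Y).getLast? = some a := by
    have := h.last
    rw [hT] at this
    simpa using this
  have e : T = (X ++ [a']) ++ (b' :: Y) := by simp [hT]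
  refine ⟨(b' :: Y) ++ (X ++ [a']), h.toIsTour.perm (e ▸ List.perm_append_comm) (by simp)
    (getLast?_append_of (by simp)),
    fun a'' b'' T'' h'' => ?_⟩
  have := h.le a'' b'' T'' h''
  rw [e, pathSum_append f (s := a') (u := b') (by simp) (by simp)] at this
  rw [pathSum_append f hY hX]
  omega

/-- Exchange of two pairs. -/
theorem IsOptTour.two_opt (hf : ∀ x y, f x y = f y x) (h : IsOptTour f a b T) {s u : V}
    {X Y : List V} (hT : T = X ++ s :: u :: Y) : f s u + f a b ≤ f s a + f u b := by
  have e : T = (X ++ [s]) ++ (u :: Y) := by simp [hT]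
  have hX : (X ++ [s]).head? = some b := by
    have := h.head
    rw [hT] at this
    cases X <;> simpa using this
  have hY : (u :: Y).getLast? = some a := by
    have := h.last
    rw [hT] at this
    simpa using this
  -- The competitor reverses the initial segment: `s … b, u … a`, closed by `(a, s)`.
  have h1 := h.le a s ((X ++ [s]).reverse ++ (u :: Y)) (h.toIsTour.perm
    (e ▸ (List.reverse_perm _).symm.append_right _) (by simp)
    (getLast?_append_of hY))
  rw [pathSum_append f (s := b) (u := u) (by rw [List.getLast?_reverse, hX]) (by simp), pathSum_reverse hf, e,
    pathSum_append f (s := s) (u := u) (by simp) (by simp), hf a s, hf b u] at h1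
  omega

/-- Exchange of three pairs. -/
theorem IsOptTour.three_opt (hf : ∀ x y, f x y = f y x) (h : IsOptTour f a b T) {s u s' u' : V}
    {X Y Z : List V} (hT : T = (X ++ [s]) ++ (Y ++ Z)) (hu : Y.head? = some u)
    (hs' : Y.getLast? = some s') (hu' : Z.head? = some u') :
    f s u + f s' u' + f a b ≤ f s s' + f u a + f u' b := by
  have hX : (X ++ [s]).head? = some b := by
    have := h.head
    rw [hT] at this
    cases X <;> simpa using this
  have hZ : Z.getLast? = some a := by
    have := h.last
    rw [hT] at this
    cases Z with
    | nil => simp at hu'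
    | cons z Z =>
      rw [List.getLast?_append, List.getLast?_append] at this
      simpa [List.getLast?_cons] using this
  have hYZ : (Y ++ Z).head? = some u := by cases Y <;> simp_all
  have hXZ : ((X ++ [s]).reverse ++ Z).head? = some s := by simp
  have hXZ' : ((X ++ [s]).reverse ++ Z).getLast? = some a :=
    getLast?_append_of hZ
  -- The competitor is `u … s', s … b, u' … a`, closed by `(a, u)`.
  have h1 := h.le a u (Y ++ ((X ++ [s]).reverse ++ Z)) (h.toIsTour.perm
    (by
      rw [hT]
      refine List.perm_append_comm.trans ?_
      rw [List.append_assoc]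
      refine List.Perm.append_left _ (List.perm_append_comm.trans ?_)
      exact (List.reverse_perm _).symm.append_right _)
    (by cases Y <;> simp_all) (getLast?_append_of hXZ'))
  rw [hT, pathSum_append f (s := s) (u := u) (by simp) hYZ, pathSum_append f hs' hu',
    pathSum_append f hs' hXZ, pathSum_append f (s := b) (u := u') (by rw [List.getLast?_reverse, hX]) hu',
    pathSum_reverse hf, hf s' s, hf a u, hf b u'] at h1
  omega

/-- A weight function `δ` and a natural number function that grows by a factor `K` with `δ`. -/
structure Grows (δ : V → V → ℝ) (f : V → V → ℕ) (K : ℕ) : Prop where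
  symm : ∀ x y, f x y = f y x
  pos : ∀ x y, 0 < f x y
  mul_le : ∀ x y x' y', δ x y < δ x' y' → K * f x y ≤ f x' y'

theorem exists_grows [Fintype V] {δ : V → V → ℝ} (hδ : ∀ x y, δ x y = δ y x) {K : ℕ}
    (hK : 0 < K) : ∃ f, Grows δ f K := by
  classical
  -- The rank of a distance: it increases strictly from one attained value to a larger one, and `K ^
  -- r` turns this into a factor `K`.
  let r : ℝ → ℕ := fun d => (Finset.univ.filter fun z : V × V => δ z.1 z.2 < d).card
  refine ⟨fun x y => K ^ r (δ x y), fun x y => by rw [hδ], fun x y => by positivity,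
    fun x y x' y' h => ?_⟩
  have : r (δ x y) < r (δ x' y') := by
    refine Finset.card_lt_card (Finset.ssubset_iff_subset_ne.2 ⟨fun z => ?_, fun e => ?_⟩)
    · simpa using fun h' => h'.trans h
    · have : (x, y) ∈ Finset.univ.filter fun z : V × V => δ z.1 z.2 < δ x' y' := by simpa using h
      rw [← e] at this
      simp at this
  rw [← pow_succ']
  exact Nat.pow_le_pow_right hK this

variable {δ : V → V → ℝ} {K : ℕ}

/-- Otherwise both added pairs of the two-exchange are shorter than the longest removed pair, so
each costs at most a quarter of it and the exchange lowers the cost. -/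
theorem IsOptTour.le_of_pred (hf : Grows δ f K) (hK : 4 ≤ K)
    (h : IsOptTour f a b T) {s u : V} {X Y : List V} (hT : T = X ++ s :: u :: Y)
    (hub : δ u b < δ a b) : δ s u ≤ δ s a ∧ δ a b ≤ δ s a := by
  have key := h.two_opt hf.symm hT
  have p1 := hf.pos s u
  have p2 := hf.pos a b
  by_contra hc
  have hc' : δ s a < max (δ s u) (δ a b) := by
    by_contra hh
    exact hc (max_le_iff.1 (not_lt.1 hh))
  rcases le_total (δ s u) (δ a b) with hle | hle
  · rw [max_eq_right hle] at hc'
    have h1 := hf.mul_le _ _ _ _ hc'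
    have h2 := hf.mul_le _ _ _ _ hub
    nlinarith
  · rw [max_eq_left hle] at hc'
    have h1 := hf.mul_le _ _ _ _ hc'
    have h2 := hf.mul_le _ _ _ _ (hub.trans_le hle)
    nlinarith

/-- The same argument for the three-exchange: three added pairs cost at most `3 / 4` of the longest
removed pair, which is why `4 ≤ K` is required. -/
theorem IsOptTour.le_of_pred_pred (hf : Grows δ f K) (hK : 4 ≤ K)
    (h : IsOptTour f a b T) {s u s' u' : V} {X Y Z : List V} (hT : T = (X ++ [s]) ++ (Y ++ Z))
    (hu : Y.head? = some u) (hs' : Y.getLast? = some s') (hu' : Z.head? = some u')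
    (hua : δ u a < δ a b) (hub : δ u' b < δ a b) :
    δ s u ≤ δ s s' ∧ δ s' u' ≤ δ s s' ∧ δ a b ≤ δ s s' := by
  have key := h.three_opt hf.symm hT hu hs' hu'
  by_contra hc
  obtain ⟨x, y, hxy, hle, hm⟩ : ∃ x y, δ s s' < δ x y ∧ δ a b ≤ δ x y ∧
      f x y ≤ f s u + f s' u' + f a b := by
    by_cases h3 : δ s s' < δ a b
    · exact ⟨a, b, h3, le_rfl, by omega⟩
    · by_cases h1 : δ s s' < δ s u
      · exact ⟨s, u, h1, by linarith, by omega⟩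
      · exact ⟨s', u', by_contra fun h2 => hc ⟨not_lt.1 h1, not_lt.1 h2, not_lt.1 h3⟩,
          by_contra fun h2 => hc ⟨not_lt.1 h1, by linarith, not_lt.1 h3⟩, by omega⟩
  have p := hf.pos x y
  have h1 := hf.mul_le _ _ _ _ hxy
  have h2 := hf.mul_le _ _ _ _ (hua.trans_le hle)
  have h3 := hf.mul_le _ _ _ _ (hub.trans_le hle)
  nlinarith

/-- Two consecutive pairs of a list, with distinct second entries, occur one after the other. -/
theorem exists_split_of_pairs {s u s' u' : V} {X Y X' Y' : List V} (hT : T = X ++ s :: u :: Y)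
    (hT' : T = X' ++ s' :: u' :: Y') (hu : u ≠ u') :
    (∃ A B C, T = (A ++ [s]) ++ (B ++ C) ∧ B.head? = some u ∧ B.getLast? = some s' ∧
      C.head? = some u') ∨
    (∃ A B C, T = (A ++ [s']) ++ (B ++ C) ∧ B.head? = some u' ∧ B.getLast? = some s ∧
      C.head? = some u) := by
  have e : (X ++ [s]) ++ (u :: Y) = (X' ++ [s']) ++ (u' :: Y') := by simp [← hT, ← hT']
  rcases List.append_eq_append_iff.1 e with ⟨B, h1, h2⟩ | ⟨B, h1, h2⟩
  · left
    rcases B.eq_nil_or_concat' with rfl | ⟨B, z, rfl⟩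
    · simp_all
    · refine ⟨X, B ++ [z], u' :: Y', ?_, ?_, ?_, rfl⟩
      · rw [← h2, hT]; simp
      · have := congrArg List.head? h2
        cases B <;> simpa using this.symm
      · have := congrArg List.getLast? h1
        simpa [← List.append_assoc] using this.symm
  · right
    rcases B.eq_nil_or_concat' with rfl | ⟨B, z, rfl⟩
    · simp_all
    · refine ⟨X', B ++ [z], u :: Y, ?_, ?_, ?_, rfl⟩
      · rw [← h2, hT']; simp
      · have := congrArg List.head? h2
        cases B <;> simpa using this.symm
      · have := congrArg List.getLast? h1
        simpa [← List.append_assoc] using this.symm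

theorem IsTour.exists_pred (h : IsTour a b T) {u : V} (hu : u ≠ b) :
    ∃ s X Y, T = X ++ s :: u :: Y := by
  obtain ⟨X, Y, e⟩ := List.append_of_mem (h.mem u)
  rcases X.eq_nil_or_concat' with rfl | ⟨X, s, rfl⟩
  · have := h.head
    simp_all
  · exact ⟨s, X, Y, by simp [e]⟩

end Tours

/-! ### From tours to Hamiltonian cycles, and minimum cost implies minimum bottleneck. -/

section Walks

variable {V : Type*} {a b : V} {T : List V}

theorem exists_walk_support : ∀ {L : List V} {x y : V}, L.IsChain (· ≠ ·) → L.head? = some x →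
    L.getLast? = some y → ∃ p : (⊤ : SimpleGraph V).Walk x y, p.support = L
  | [], _, _, _, h, _ => by simp at h
  | [z], x, y, _, hx, hy => by
    simp only [List.getLast?_singleton, List.head?_cons, Option.some.injEq] at hx hy
    subst hx hy
    exact ⟨.nil, rfl⟩
  | z :: z' :: L, x, y, hc, hx, hy => by
    simp only [List.head?_cons, Option.some.injEq] at hx
    subst hx
    obtain ⟨p, hp⟩ := exists_walk_support (L := z' :: L) (x := z') (y := y)
      (List.isChain_cons_cons.1 hc).2 rfl (by simpa using hy)
    exact ⟨.cons (List.isChain_cons_cons.1 hc).1 p, by simp [hp]⟩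

theorem IsTour.exists_walk [DecidableEq V] (h : IsTour a b T) (hT : 3 ≤ T.length) :
    ∃ c : (⊤ : SimpleGraph V).Walk a a, c.IsHamiltonianCycle ∧ c.support = a :: T := by
  have hab : a ≠ b := by
    rintro rfl
    obtain ⟨X, rfl⟩ := List.getLast?_eq_some_iff.1 h.last
    cases X with
    | nil => simp at hT
    | cons x X =>
      have h1 := h.head
      have h2 := h.nodup
      simp_all
  have hc : (a :: T).IsChain (· ≠ ·) := by
    rw [List.isChain_cons]
    refine ⟨fun y hy => ?_, (List.nodup_iff_pairwise_ne.1 h.nodup).isChain⟩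
    rw [h.head] at hy
    simp only [Option.mem_def, Option.some.injEq] at hy
    exact hy ▸ hab
  obtain ⟨c, hc⟩ := exists_walk_support hc (x := a) (y := a) rfl (by
    have : a :: T = [a] ++ T := rfl
    rw [this, getLast?_append_of h.last])
  have hlen : 3 ≤ c.length := by
    have := c.length_support
    rw [hc, List.length_cons] at this
    omega
  have htail : c.support.tail = T := by rw [hc]; rfl
  have hnil : ¬ c.Nil := by
    rw [SimpleGraph.Walk.not_nil_iff_lt_length]; omega
  refine ⟨c, ?_, hc⟩
  rw [SimpleGraph.Walk.isHamiltonianCycle_iff_isCycle_and_support_count_tail_eq_one,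
    SimpleGraph.Walk.isCycle_iff_isPath_tail_and_le_length, SimpleGraph.Walk.isPath_def,
    SimpleGraph.Walk.support_tail_of_not_nil _ hnil, htail]
  exact ⟨⟨h.nodup, hlen⟩, fun x => List.count_eq_one_of_mem h.nodup (h.mem x)⟩

variable {G : SimpleGraph V}

theorem nodup_support_tail [DecidableEq V] {v : V} {c : G.Walk v v} (hc : c.IsHamiltonianCycle) :
    c.support.tail.Nodup ∧ ∀ x, x ∈ c.support.tail := by
  rw [SimpleGraph.Walk.isHamiltonianCycle_iff_isCycle_and_support_count_tail_eq_one] at hc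
  exact ⟨List.nodup_iff_count_le_one.2 fun x => (hc.2 x).le,
    fun x => List.count_pos_iff.1 (by rw [hc.2 x]; exact one_pos)⟩

theorem exists_isTour_of_isHamiltonianCycle [DecidableEq V] {v : V} {c : G.Walk v v}
    (hc : c.IsHamiltonianCycle) : ∃ b T, IsTour v b T ∧ c.support = v :: T := by
  have hn := nodup_support_tail hc
  cases c with
  | nil => exact absurd rfl hc.isCycle.ne_nil
  | cons h p =>
    rename_i b
    refine ⟨b, p.support, ⟨by simpa using hn.1, by simpa using hn.2, ?_, ?_⟩, by simp⟩
    · rw [List.head?_eq_some_head p.support_ne_nil, p.head_support]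
    · rw [List.getLast?_eq_some_getLast p.support_ne_nil, p.getLast_support]

theorem sum_darts (f : V → V → ℕ) : ∀ {u v : V} (p : G.Walk u v),
    (p.darts.map fun d => f d.fst d.snd).sum = pathSum f p.support
  | _, _, .nil => rfl
  | _, _, .cons h .nil => by simp [pathSum]
  | _, _, .cons h (.cons h' p) => by
    have := sum_darts f (.cons h' p)
    simp only [SimpleGraph.Walk.darts_cons, SimpleGraph.Walk.support_cons, List.map_cons,
      List.sum_cons] at this ⊢
    rw [this]
    cases p <;> simp [pathSum]

theorem exists_append_of_mem_darts {d : G.Dart} : ∀ {u v : V} {p : G.Walk u v}, d ∈ p.darts →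
    ∃ X Y, p.support = X ++ d.fst :: d.snd :: Y
  | _, _, .nil, h => by simp at h
  | u, _, .cons h p, hd => by
    rw [SimpleGraph.Walk.darts_cons, List.mem_cons] at hd
    rcases hd with rfl | hd
    · exact ⟨[], p.support.tail, by simp [SimpleGraph.Walk.cons_tail_support]⟩
    · obtain ⟨X, Y, e⟩ := exists_append_of_mem_darts hd
      exact ⟨u :: X, Y, by simp [e]⟩

theorem sum_le_of_forall_mul_le {ι : Type*} {l : List ι} {g : ι → ℕ} {K m : ℕ}
    (h : ∀ i ∈ l, K * g i ≤ m) : K * (l.map g).sum ≤ l.length * m := by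
  induction l with
  | nil => simp
  | cons i l ih =>
    have h1 := h i (by simp)
    have h2 := ih fun j hj => h j (by simp [hj])
    simp only [List.map_cons, List.sum_cons, List.length_cons]
    nlinarith

variable {f : V → V → ℕ} {δ : V → V → ℝ} {K : ℕ}

/-- A Hamiltonian cycle of minimum cost minimizes the largest `δ` of a pair. -/
theorem exists_dart_le [Fintype V] [DecidableEq V] (hf : Grows δ f K) (hK : Fintype.card V < K)
    (h : IsOptTour f a b T) {c : (⊤ : SimpleGraph V).Walk a a} (hc : c.support = a :: T)
    {v : V} {c' : (⊤ : SimpleGraph V).Walk v v} (hc' : c'.IsHamiltonianCycle)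
    {d : (⊤ : SimpleGraph V).Dart} (hd : d ∈ c.darts) :
    ∃ d' ∈ c'.darts, δ d.fst d.snd ≤ δ d'.fst d'.snd := by
  by_contra! hlt
  have cost : ∀ {x y : V} {L : List V}, IsTour x y L → f x y + pathSum f L = pathSum f (x :: L) := by
    intro x y L hL
    rw [show x :: L = [x] ++ L from rfl, pathSum_append f (s := x) (u := y) rfl hL.head]
    simp [pathSum]
  obtain ⟨b', T', hT', e⟩ := exists_isTour_of_isHamiltonianCycle hc'
  have hle := h.le _ _ _ hT'
  rw [cost h.toIsTour, cost hT', ← e, ← hc, ← sum_darts, ← sum_darts] at hle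
  have h1 : f d.fst d.snd ≤ (c.darts.map fun d => f d.fst d.snd).sum :=
    List.le_sum_of_mem (List.mem_map_of_mem (f := fun d => f d.fst d.snd) hd)
  have h2 := sum_le_of_forall_mul_le (l := c'.darts) (g := fun d => f d.fst d.snd) (K := K)
    fun d' hd' => hf.mul_le _ _ _ _ (hlt d' hd')
  rw [SimpleGraph.Walk.length_darts, hc'.length_eq] at h2
  have := hf.pos d.fst d.snd
  -- With `n` points, `K * f d ≤ K * cost c' ≤ n * f d`, contradicting `n < K`.
  have h3 := Nat.mul_le_mul_left K (h1.trans hle)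
  nlinarith

end Walks

/-! ### The hexagonal distance and the triangle `t(p, q)`. -/

/-- The norm of the plane, in the coordinates given by two sides of `▽`, whose unit ball is a
regular hexagon. -/
def hexNorm (x y : ℝ) : ℝ := max |x| (max |y| |x + y|)

theorem hexNorm_lt_iff {x y r : ℝ} : hexNorm x y < r ↔
    (-x < r ∧ x < r) ∧ (-y < r ∧ y < r) ∧ (-(x + y) < r ∧ x + y < r) := by
  simp only [hexNorm, max_lt_iff, abs_lt, neg_lt]

theorem le_hexNorm_iff {x y r : ℝ} : r ≤ hexNorm x y ↔
    (r ≤ -x ∨ r ≤ x) ∨ (r ≤ -y ∨ r ≤ y) ∨ (r ≤ -(x + y) ∨ r ≤ x + y) := by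
  simp only [hexNorm, le_max_iff, le_abs, or_comm]

theorem hexNorm_le_iff {x y r : ℝ} : hexNorm x y ≤ r ↔
    (-x ≤ r ∧ x ≤ r) ∧ (-y ≤ r ∧ y ≤ r) ∧ (-(x + y) ≤ r ∧ x + y ≤ r) := by
  simp only [hexNorm, max_le_iff, abs_le, neg_le]

/-- The distance whose value at `p`, `q` is `3 / 2` times the scaling factor of `t(p, q)`. -/
noncomputable def delta (p q : Plane) : ℝ :=
  max (side 0 p) (side 0 q) + max (side 1 p) (side 1 q) + max (side 2 p) (side 2 q)

theorem delta_comm (p q : Plane) : delta p q = delta q p := by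
  simp only [delta, max_comm]

theorem exists_third (i j : Fin 3) (h : i ≠ j) :
    ∃ k, ∀ g : Fin 3 → ℝ, g i + g j + g k = g 0 + g 1 + g 2 := by
  fin_cases i <;> fin_cases j <;> simp only [ne_eq, not_true_eq_false] at h
  · exact ⟨2, fun g => rfl⟩
  · exact ⟨1, fun g => by change g 0 + g 2 + g 1 = _; ring⟩
  · exact ⟨2, fun g => by change g 1 + g 0 + g 2 = _; ring⟩
  · exact ⟨0, fun g => by change g 1 + g 2 + g 0 = _; ring⟩
  · exact ⟨1, fun g => by change g 2 + g 0 + g 1 = _; ring⟩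
  · exact ⟨0, fun g => by change g 2 + g 1 + g 0 = _; ring⟩

/-- The three side values of a point sum to zero, so the sum of the maxima is the sum of the
positive parts of three differences with sum zero. That is the largest absolute value among them. -/
theorem delta_eq_hexNorm {i j : Fin 3} (h : i ≠ j) (p q : Plane) :
    delta p q = hexNorm (side i p - side i q) (side j p - side j q) := by
  have hp := side_sum p
  have hq := side_sum q
  have key : ∀ x y z x' y' z' : ℝ, x + y + z = 0 → x' + y' + z' = 0 →
      max x x' + max y y' + max z z' = hexNorm (x - x') (y - y') := by
    intro x y z x' y' z' h h'
    refine le_antisymm (le_hexNorm_iff.2 ?_) (hexNorm_le_iff.2 ?_)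
    · rcases max_cases x x' with ⟨e1, _⟩ | ⟨e1, _⟩ <;> rcases max_cases y y' with ⟨e2, _⟩ | ⟨e2, _⟩ <;>
        rcases max_cases z z' with ⟨e3, _⟩ | ⟨e3, _⟩ <;> rw [e1, e2, e3]
      · exact .inl (.inr (by linarith))
      · exact .inr (.inr (.inr (by linarith)))
      · exact .inr (.inl (.inl (by linarith)))
      · exact .inl (.inr (by linarith))
      · exact .inl (.inl (by linarith))
      · exact .inr (.inl (.inr (by linarith)))
      · exact .inr (.inr (.inl (by linarith)))
      · exact .inl (.inl (by linarith))
    · have := le_max_left x x'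
      have := le_max_right x x'
      have := le_max_left y y'
      have := le_max_right y y'
      have := le_max_left z z'
      have := le_max_right z z'
      refine ⟨⟨?_, ?_⟩, ⟨?_, ?_⟩, ?_, ?_⟩ <;> linarith
  obtain ⟨k, hk⟩ := exists_third i j h
  rw [← key (side i p) (side j p) (side k p) (side i q) (side j q) (side k q)
    ((hk fun l => side l p).trans hp) ((hk fun l => side l q).trans hq)]
  exact (hk fun l => max (side l p) (side l q)).symm

theorem delta_nonneg (p q : Plane) : 0 ≤ delta p q := by
  rw [delta_eq_hexNorm (i := 0) (j := 1) (by decide)]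
  exact (abs_nonneg _).trans (le_max_left _ _)

/-- Each side of the smallest triangle is pushed in until it meets `p` or `q`. Summing the three
side conditions cancels the center and leaves the scaling factor. -/
theorem t_eq_homothet (p q : Plane) : ∃ b, t p q = homothet b (2 / 3 * delta p q) ∧
    ∀ i, side i b + 2 / 3 * delta p q / 2 = max (side i p) (side i q) := by
  have exists_center : ∀ c : Fin 3 → ℝ, ∃ b, ∀ i, side i b + (c 0 + c 1 + c 2) / 3 = c i := by
    intro c
    refine ⟨!₂[(c 1 - c 2) / √3, c 0 - (c 0 + c 1 + c 2) / 3], fun i => ?_⟩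
    have e : √3 / 2 * ((c 1 - c 2) / √3) = (c 1 - c 2) / 2 := by
      have : √3 ≠ 0 := by positivity
      field_simp
    fin_cases i
    · change side 0 _ + _ = c 0
      rw [side_zero]; simp
    · change side 1 _ + _ = c 1
      rw [side_one]; simp only [Matrix.cons_val_zero, Matrix.cons_val_one]
      rw [e]; ring
    · change side 2 _ + _ = c 2
      rw [side_two]; simp only [Matrix.cons_val_zero, Matrix.cons_val_one]
      rw [e]; ring
  obtain ⟨b, hb⟩ := exists_center fun i => max (side i p) (side i q)
  have hb' : ∀ i, side i b + 2 / 3 * delta p q / 2 = max (side i p) (side i q) := fun i => by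
    rw [← hb i, delta]; ring
  have h0 : 0 ≤ 2 / 3 * delta p q := by have := delta_nonneg p q; positivity
  have front : ∀ x y, delta x y = delta p q → (∀ i, max (side i x) (side i y) =
      max (side i p) (side i q)) → x ∈ frontier (homothet b (2 / 3 * delta p q)) := by
    intro x y hxy h
    refine (mem_frontier_homothet h0 x).2 ⟨fun i => by rw [hb', ← h]; exact le_max_left _ _, ?_⟩
    by_contra! hne
    have hlt : ∀ i, side i x < side i y := fun i => by
      have := hne i
      rw [hb', ← h] at this
      exact not_le.1 fun hle => this (max_eq_left hle).symm
    linarith [hlt 0, hlt 1, hlt 2, side_sum x, side_sum y]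
  refine ⟨b, (existsUnique_isSmallestHomothet p q).unique (isSmallestHomothet_t p q)
    ⟨b, _, h0, rfl, front p q rfl fun _ => rfl, front q p (delta_comm q p) fun _ => max_comm _ _,
      fun b' μ h hp hq => ?_⟩, hb'⟩
  have key : ∀ i, max (side i p) (side i q) ≤ side i b' + μ / 2 := fun i =>
    max_le (((mem_frontier_homothet h p).1 hp).1 i) (((mem_frontier_homothet h q).1 hq).1 i)
  rw [delta]
  linarith [key 0, key 1, key 2, side_sum b']

theorem mem_interior_t {p q x : Plane} :
    x ∈ interior (t p q) ↔ ∀ i, side i x < max (side i p) (side i q) := by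
  obtain ⟨b, e, h⟩ := t_eq_homothet p q
  have h0 : 0 ≤ 2 / 3 * delta p q := by have := delta_nonneg p q; positivity
  rw [e, interior_homothet h0]
  simp only [Set.mem_ofPred_eq, h]

theorem volume_homothet (b : Plane) (μ : ℝ) :
    volume (homothet b μ) = ENNReal.ofReal (μ ^ 2) * volume downTriangle := by
  have e : homothet b μ = (fun x => b + x) '' (μ • downTriangle) := by
    rw [homothet, ← Set.image_smul, Set.image_image]
  rw [e, Set.image_add_left, measure_preimage_add, Measure.addHaar_smul]
  simp

theorem volume_downTriangle_pos : 0 < volume downTriangle := by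
  have h : downTriangle = homothet 0 1 := by simp [homothet]
  refine Measure.measure_pos_of_nonempty_interior _ ⟨0, ?_⟩
  rw [h, interior_homothet zero_le_one]
  simp

theorem volume_downTriangle_ne_top : volume downTriangle ≠ ⊤ := by
  have h : IsCompact downTriangle :=
    Set.Finite.isCompact_convexHull (𝕜 := ℝ) (Set.toFinite {!₂[0, -1], !₂[√3 / 2, 1 / 2], _})
  exact h.measure_lt_top.ne

theorem weight_le_weight_iff {p q p' q' : Plane} :
    weight p q ≤ weight p' q' ↔ delta p q ≤ delta p' q' := by
  have hw : ∀ p q, weight p q = ENNReal.ofReal ((2 / 3 * delta p q) ^ 2) * volume downTriangle := by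
    intro p q
    obtain ⟨b, e, -⟩ := t_eq_homothet p q
    rw [weight, e, volume_homothet]
  have h := delta_nonneg p q
  have h' := delta_nonneg p' q'
  rw [hw, hw, ENNReal.mul_le_mul_iff_left volume_downTriangle_pos.ne' volume_downTriangle_ne_top,
    ENNReal.ofReal_le_ofReal_iff (by positivity), sq_le_sq₀ (by positivity) (by positivity)]
  constructor <;> intro <;> linarith

/-! ### Seven regions outside a hexagon. -/

/-- The number of the region of the point with coordinates `x`, `y`, in a partition of the outside
of the hexagon of radius `D` into seven regions. -/
noncomputable def region (D x y : ℝ) : Fin 7 :=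
  if y ≤ 0 then if x + y ≤ D then 0 else 1
  else if x ≤ 0 then if x + y ≤ D then 2 else 3
  else if D ≤ x then 4 else if D ≤ y then 5 else 6

/-- The point `(x, y)` is at hexagonal distance at least `D` and `r` from the origin, and at
distance less than `r` from a point of the open triangle `0 < x`, `0 < y`, `x + y < D`. -/
structure IsOuter (D x y r : ℝ) : Prop where
  hx : x - D < r
  hy : y - D < r
  hz : x + y - D < r
  hx' : -x < r
  hy' : -y < r
  hz' : -(x + y) < r
  far : D ≤ hexNorm x y
  far' : r ≤ hexNorm x y

/-- Being within `r` of the triangle rules out three of the six directions in which the hexagonal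
norm can reach `max D r`. -/
theorem IsOuter.cases {D x y r : ℝ} (h : IsOuter D x y r) :
    (r ≤ x ∧ D ≤ x) ∨ (r ≤ y ∧ D ≤ y) ∨ (r ≤ x + y ∧ D ≤ x + y) := by
  obtain ⟨h1, h2, h3, h4, h5, h6, h7, h8⟩ := h
  have h : max D r ≤ hexNorm x y := max_le h7 h8
  have l1 := le_max_left D r
  have l2 := le_max_right D r
  rcases le_hexNorm_iff.1 h with (h | h) | (h | h) | (h | h)
  · linarith
  · exact .inl ⟨by linarith, by linarith⟩
  · linarith
  · exact .inr (.inl ⟨by linarith, by linarith⟩)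
  · linarith
  · exact .inr (.inr ⟨by linarith, by linarith⟩)

/-- Within one region the differences of `x`, of `y` and of `x + y` all stay below the largest of
`D`, `r`, `r'`, so the two points would be too close. Each combination of region and far directions
is a linear problem. -/
theorem region_ne {D x y r x' y' r' : ℝ} (h : IsOuter D x y r) (h' : IsOuter D x' y' r')
    (hD : D ≤ hexNorm (x - x') (y - y')) (hr : r ≤ hexNorm (x - x') (y - y'))
    (hr' : r' ≤ hexNorm (x - x') (y - y')) : region D x y ≠ region D x' y' := by
  intro e
  have hc := h.cases
  have hc' := h'.cases
  obtain ⟨h1, h2, h3, h4, h5, h6, -, -⟩ := h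
  obtain ⟨g1, g2, g3, g4, g5, g6, -, -⟩ := h'
  have hm : max D (max r r') ≤ hexNorm (x - x') (y - y') := max_le hD (max_le hr hr')
  have l1 := le_max_left D (max r r')
  have l2 := (le_max_left r r').trans (le_max_right D (max r r'))
  have l3 := (le_max_right r r').trans (le_max_right D (max r r'))
  generalize max D (max r r') = m at *
  suffices hexNorm (x - x') (y - y') < m from absurd hm (not_le.2 this)
  clear hD hr hr' hm
  rw [hexNorm_lt_iff]
  unfold region at e
  split_ifs at e <;> first | exact absurd e (by decide) | skip
  all_goals
    clear e
    rcases hc with ⟨c1, c2⟩ | ⟨c1, c2⟩ | ⟨c1, c2⟩ <;>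
    rcases hc' with ⟨d1, d2⟩ | ⟨d1, d2⟩ | ⟨d1, d2⟩ <;>
    refine ⟨⟨?_, ?_⟩, ⟨?_, ?_⟩, ?_, ?_⟩ <;> linarith

/-! ### At most seven points inside the triangle of an edge. -/

section UpperBound

variable {P : Finset Plane} {f : P → P → ℕ} {K : ℕ} {a b : P} {T : List P}

/-- Here `a` is a corner of `t(a, b)` and `b` lies on the opposite side. With `a` as origin the
interior is `0 < x`, `0 < y`, `x + y < D`, and a point in it is sent to the region of its
predecessor. -/
theorem ncard_interior_le_of_corner (hf : Grows (fun p q : P => delta p q) f K) (hK : 4 ≤ K)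
    (h : IsOptTour f a b T) {i j : Fin 3} (hij : i ≠ j) (hi : side i b ≤ side i (a : Plane))
    (hj : side j b ≤ side j (a : Plane)) :
    ((P : Set Plane) ∩ interior (t a b)).ncard ≤ 7 := by
  obtain ⟨k, hk⟩ := exists_third i j hij
  have hk' : ∀ p, side k p = -(side i p + side j p) := fun p => by
    linear_combination hk (fun l => side l p) + side_sum p
  set D := delta a b with hDdef
  have hdelta := fun p q => delta_eq_hexNorm hij p q
  set x : Plane → ℝ := fun p => side i a - side i p with hx
  set y : Plane → ℝ := fun p => side j a - side j p with hy
  have hxy : ∀ p q, delta p q = hexNorm (x p - x q) (y p - y q) := fun p q => by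
    rw [delta_comm, hdelta]; simp only [hx, hy]; congr 1 <;> ring
  have hxa : x a = 0 := sub_self _
  have hya : y a = 0 := sub_self _
  have hxb : 0 ≤ x b := sub_nonneg.2 hi
  have hyb : 0 ≤ y b := sub_nonneg.2 hj
  have hD : D = x b + y b := by
    rw [hDdef, delta_comm, hxy, hxa, hya, sub_zero, sub_zero]
    exact le_antisymm (hexNorm_le_iff.2 (by refine ⟨⟨?_, ?_⟩, ⟨?_, ?_⟩, ?_, ?_⟩ <;> linarith))
      (le_hexNorm_iff.2 (.inr (.inr (.inr le_rfl))))
  have hu : ∀ u ∈ interior (t a b), 0 < x u ∧ 0 < y u ∧ x u + y u < D := by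
    intro u hu
    rw [mem_interior_t] at hu
    have h1 := hu i
    have h2 := hu j
    have h3 := hu k
    rw [max_eq_left hi] at h1
    rw [max_eq_left hj] at h2
    have hab : side k a ≤ side k (b : Plane) := by rw [hk', hk']; linarith
    rw [max_eq_right hab, hk', hk'] at h3
    refine ⟨sub_pos.2 h1, sub_pos.2 h2, ?_⟩
    simp only [hD, hx, hy]
    linarith
  have hua : ∀ u ∈ interior (t a b), delta u a < D := by
    intro u hu'
    obtain ⟨h1, h2, h3⟩ := hu u hu'
    rw [hxy, hxa, hya, sub_zero, sub_zero, hexNorm_lt_iff]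
    refine ⟨⟨?_, ?_⟩, ⟨?_, ?_⟩, ?_, ?_⟩ <;> linarith
  have hub : ∀ u ∈ interior (t a b), delta u b < D := by
    intro u hu'
    obtain ⟨h1, h2, h3⟩ := hu u hu'
    rw [hxy, hexNorm_lt_iff]
    refine ⟨⟨?_, ?_⟩, ⟨?_, ?_⟩, ?_, ?_⟩ <;> linarith
  have hex : ∀ u : Plane, ∃ n : Fin 7, u ∈ (P : Set Plane) ∩ interior (t a b) →
      ∃ (hu : u ∈ P) (s : P) (X Y : List P), T = X ++ s :: ⟨u, hu⟩ :: Y ∧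
        n = region D (x s) (y s) := by
    intro u
    by_cases hu' : u ∈ (P : Set Plane) ∩ interior (t a b)
    -- `b` satisfies `x + y = D`, so `u` is not the first point of the tour and has a predecessor.
    · obtain ⟨s, X, Y, e⟩ := h.toIsTour.exists_pred (u := ⟨u, hu'.1⟩) (by
        intro e
        obtain ⟨-, -, h3⟩ := hu u hu'.2
        rw [show u = b from congrArg Subtype.val e, hD] at h3
        exact lt_irrefl _ h3)
      exact ⟨_, fun _ => ⟨hu'.1, s, X, Y, e, rfl⟩⟩
    · exact ⟨0, fun h => absurd h hu'⟩
  choose φ hφ using hex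
  have outer : ∀ (u s : P) (X Y : List P), (u : Plane) ∈ interior (t a b) →
      T = X ++ s :: u :: Y → IsOuter D (x s) (y s) (delta s u) := by
    intro u s X Y hu' e
    obtain ⟨h1, h2⟩ := h.le_of_pred hf hK e (hub u hu')
    obtain ⟨g1, g2, g3⟩ := hu u hu'
    rw [hxy s a, hxa, hya, sub_zero, sub_zero] at h1 h2
    obtain ⟨⟨c1, c2⟩, ⟨c3, c4⟩, c5, c6⟩ := hexNorm_le_iff.1 (hxy s u).ge
    constructor <;> linarith
  have inj : Set.InjOn φ ((P : Set Plane) ∩ interior (t a b)) := by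
    intro u hu₁ u' hu₂ he
    by_contra hne
    obtain ⟨hP, s, X, Y, e, hn⟩ := hφ u hu₁
    obtain ⟨hP', s', X', Y', e', hn'⟩ := hφ u' hu₂
    have o := outer _ _ _ _ hu₁.2 e
    have o' := outer _ _ _ _ hu₂.2 e'
    rw [hn, hn'] at he
    -- Whichever of `u`, `u'` comes first along the tour is joined to `a` in the three-exchange, the
    -- other to `b`.
    rcases exists_split_of_pairs e e' (by simpa using hne) with
      ⟨A, B, C, hT, hB, hB', hC⟩ | ⟨A, B, C, hT, hB, hB', hC⟩
    · obtain ⟨h1, h2, h3⟩ := h.le_of_pred_pred hf hK hT hB hB' hC (hua u hu₁.2) (hub u' hu₂.2)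
      rw [hxy s s'] at h1 h2 h3
      exact region_ne o o' h3 h1 h2 he
    · obtain ⟨h1, h2, h3⟩ := h.le_of_pred_pred hf hK hT hB hB' hC (hua u' hu₂.2) (hub u hu₁.2)
      rw [hxy s' s] at h1 h2 h3
      exact region_ne o' o h3 h1 h2 he.symm
  have := Set.ncard_le_ncard_of_injOn φ (t := Set.univ) (fun _ _ => Set.mem_univ _) inj
  simpa [Set.ncard_univ] using this

theorem ncard_interior_le (hf : Grows (fun p q : P => delta p q) f K) (hK : 4 ≤ K)
    (h : IsOptTour f a b T) : ((P : Set Plane) ∩ interior (t a b)).ncard ≤ 7 := by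
  -- By pigeonhole one of the two points attains the maximum on two of the three sides, so it is a
  -- corner. If that point is `b`, the tour is reversed.
  obtain ⟨i, j, hij, ⟨hi, hj⟩ | ⟨hi, hj⟩⟩ : ∃ i j : Fin 3, i ≠ j ∧
      ((side i b ≤ side i (a : Plane) ∧ side j b ≤ side j (a : Plane)) ∨
        (side i a ≤ side i (b : Plane) ∧ side j a ≤ side j (b : Plane))) := by
    rcases le_total (side 0 (b : Plane)) (side 0 a) with h0 | h0 <;>
    rcases le_total (side 1 (b : Plane)) (side 1 a) with h1 | h1 <;>
    rcases le_total (side 2 (b : Plane)) (side 2 a) with h2 | h2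
    · exact ⟨0, 1, by decide, .inl ⟨h0, h1⟩⟩
    · exact ⟨0, 1, by decide, .inl ⟨h0, h1⟩⟩
    · exact ⟨0, 2, by decide, .inl ⟨h0, h2⟩⟩
    · exact ⟨1, 2, by decide, .inr ⟨h1, h2⟩⟩
    · exact ⟨1, 2, by decide, .inl ⟨h1, h2⟩⟩
    · exact ⟨0, 2, by decide, .inr ⟨h0, h2⟩⟩
    · exact ⟨0, 1, by decide, .inr ⟨h0, h1⟩⟩
    · exact ⟨0, 1, by decide, .inr ⟨h0, h1⟩⟩
  · exact ncard_interior_le_of_corner hf hK h hij hi hj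
  · rw [t_comm]
    exact ncard_interior_le_of_corner hf hK (h.reverse hf.symm) hij hi hj

theorem bottleneck_le_iff {G : SimpleGraph P} {v : P} {c : G.Walk v v} {W : ENNReal} :
    bottleneck c ≤ W ↔ ∀ d ∈ c.darts, weight d.fst d.snd ≤ W := by
  simp [bottleneck]

theorem weight_le_bottleneck {G : SimpleGraph P} {v : P} {c : G.Walk v v} {d : G.Dart}
    (hd : d ∈ c.darts) : weight d.fst d.snd ≤ bottleneck c :=
  bottleneck_le_iff.1 le_rfl d hd

theorem containsBottleneckHamiltonianCycle_kTD_seven (hP : 3 ≤ P.card) :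
    ContainsBottleneckHamiltonianCycle (kTD 7 P) := by
  obtain ⟨f, hf⟩ := exists_grows (δ := fun p q : P => delta p q) (fun _ _ => delta_comm _ _)
    -- This `K` exceeds the number of points and, as `3 ≤ P.card`, is at least 4.
    (K := P.card + 1) (by omega)
  have hne : P.attach.toList ≠ [] := by
    intro h
    have := congrArg List.length h
    simp at this
    simp [this] at hP
  obtain ⟨a, b, T, hT⟩ := exists_isOptTour f (a := P.attach.toList.getLast hne)
    (b := P.attach.toList.head hne) (T := P.attach.toList)
    ⟨Finset.nodup_toList _, by simp, List.head?_eq_some_head hne,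
      List.getLast?_eq_some_getLast hne⟩
  have hlen : T.length = P.card := by
    rw [← Fintype.card_coe, ← List.toFinset_card_of_nodup hT.nodup, ← Finset.card_univ]
    congr 1
    ext v
    simp [hT.mem v]
  obtain ⟨c, hc, hcT⟩ := hT.toIsTour.exists_walk (by omega)
  refine ⟨a, c, ⟨hc, fun w c' hc' => bottleneck_le_iff.2 fun d hd => ?_⟩, fun e he => ?_⟩
  · obtain ⟨d', hd', hle⟩ := exists_dart_le hf (by simp) hT hcT hc' hd
    exact (weight_le_weight_iff.2 hle).trans (weight_le_bottleneck hd')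
  · obtain ⟨d, hd, rfl⟩ := List.mem_map.1 he
    obtain ⟨X, Y, hXY⟩ := exists_append_of_mem_darts hd
    obtain ⟨T', hT'⟩ : ∃ T', IsOptTour f d.fst d.snd T' := by
      rw [hcT] at hXY
      cases X with
      | nil =>
        obtain ⟨rfl, rfl⟩ : a = d.fst ∧ T = d.snd :: Y := by simpa using hXY
        have h := hT.head
        simp only [List.head?_cons, Option.some.injEq] at h
        subst h
        exact ⟨_, hT⟩
      | cons x X => exact hT.rotate (List.cons.inj hXY).2
    exact ⟨d.adj, ncard_interior_le hf (by omega) hT'⟩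

theorem isHamiltonian_of_containsBottleneckHamiltonianCycle {G : SimpleGraph P}
    (h : ContainsBottleneckHamiltonianCycle G) : G.IsHamiltonian := by
  obtain ⟨v, c, ⟨hc, -⟩, he⟩ := h
  refine fun _ => ⟨v, c.transfer G he, ?_⟩
  rw [SimpleGraph.Walk.isHamiltonianCycle_iff_isCycle_and_support_count_tail_eq_one] at hc ⊢
  exact ⟨hc.1.transfer he, by simpa using hc.2⟩

end UpperBound

/-! ### Seventeen points that defeat order 5. -/

section LowerBound

/-- If no two consecutive points of a Hamiltonian cycle satisfy `p`, then at most half of the points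
do. -/
theorem two_mul_countP_le {V : Type*} [DecidableEq V] {G : SimpleGraph V} {v : V} {c : G.Walk v v}
    (p : V → Bool) (hp : ∀ d ∈ c.darts, p d.fst → ¬ p d.snd) :
    2 * c.support.tail.countP p ≤ c.length := by
  have e1 := c.map_fst_darts_append
  have e2 := c.cons_map_snd_darts
  have h1 : (c.darts.map fun d => d.fst).countP p = (c.darts.map fun d => d.snd).countP p := by
    have := congrArg (List.countP p) (e1.trans e2.symm)
    -- The walk is closed, so first and second entries of its darts differ only by moving `v` from
    -- one end to the other.
    rw [List.countP_append, List.countP_singleton, List.countP_cons] at this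
    omega
  have h2 : (c.darts.map fun d => d.fst).countP p ≤
      (c.darts.map fun d => d.snd).countP fun v => ¬ p v := by
    rw [List.countP_map, List.countP_map]
    refine List.countP_mono_left fun d hd h => ?_
    simpa using hp d hd h
  have h3 := List.length_eq_countP_add_countP p (l := c.darts.map fun d => d.snd)
  rw [List.length_map, SimpleGraph.Walk.length_darts] at h3
  rw [← e2, List.tail_cons]
  omega

/-- The point `q` with `side 0 q = -z.1` and `side 1 q = -z.2`. -/
noncomputable def latticePoint (z : ℤ × ℤ) : Plane := !₂[-(z.1 + 2 * z.2) / √3, -z.1]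

/-- The values of the sides of `▽` on lattice points. -/
def latticeSide (i : Fin 3) (z : ℤ × ℤ) : ℤ := ![-z.1, -z.2, z.1 + z.2] i

theorem side_latticePoint (i : Fin 3) (z : ℤ × ℤ) :
    side i (latticePoint z) = latticeSide i z := by
  have e : √3 / 2 * (-(z.1 + 2 * z.2) / √3) = -(z.1 + 2 * z.2) / 2 := by
    have : √3 ≠ 0 := by positivity
    field_simp
  fin_cases i
  · change side 0 _ = _
    rw [side_zero]; simp [latticePoint, latticeSide]
  · change side 1 _ = _
    rw [side_one]; simp only [latticePoint, Matrix.cons_val_zero, Matrix.cons_val_one]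
    rw [e]; simp [latticeSide]; ring
  · change side 2 _ = _
    rw [side_two]; simp only [latticePoint, Matrix.cons_val_zero, Matrix.cons_val_one]
    rw [e]; simp [latticeSide]; ring

theorem latticePoint_injective : Function.Injective latticePoint := by
  intro z w h
  have h0 := side_latticePoint 0 z
  have h1 := side_latticePoint 1 z
  rw [h, side_latticePoint] at h0 h1
  simp only [latticeSide, Matrix.cons_val_zero, Matrix.cons_val_one, Int.cast_inj, neg_inj] at h0 h1
  exact Prod.ext h0.symm h1.symm

/-- The distance `delta` of lattice points. -/
def latticeDelta (z w : ℤ × ℤ) : ℤ :=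
  max (latticeSide 0 z) (latticeSide 0 w) + max (latticeSide 1 z) (latticeSide 1 w) +
    max (latticeSide 2 z) (latticeSide 2 w)

theorem delta_latticePoint (z w : ℤ × ℤ) :
    delta (latticePoint z) (latticePoint w) = latticeDelta z w := by
  simp only [delta, side_latticePoint, latticeDelta]
  push_cast
  rfl

theorem latticePoint_mem_interior_t {z w x : ℤ × ℤ}
    (h : ∀ i, latticeSide i x < max (latticeSide i z) (latticeSide i w)) :
    latticePoint x ∈ interior (t (latticePoint z) (latticePoint w)) := by
  rw [mem_interior_t]
  intro i
  simp only [side_latticePoint]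
  exact_mod_cast h i

/-- Seventeen points, in the order of a bottleneck Hamiltonian cycle. -/
def exampleList : List (ℤ × ℤ) :=
  [(50, 50), (60, 38), (152, 45), (210, 40), (300, -20), (230, -40), (195, -70), (96, 2),
    (102, -95), (4, 4), (-95, 102), (2, 96), (-70, 195), (3, 95), (45, 152), (38, 60), (0, 0)]

/-- Nine points, any two of which, except the first two, are far from each other. -/
def exampleFar : Finset (ℤ × ℤ) :=
  {(0, 0), (50, 50), (102, -95), (195, -70), (152, 45), (45, 152), (-70, 195), (-95, 102),
    (300, -20)}

/-- Six points in the triangle of the first two points of `exampleFar`. -/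
def exampleInner : Finset (ℤ × ℤ) :=
  {(60, 38), (96, 2), (4, 4), (2, 96), (3, 95), (38, 60)}

/-- The seventeen points as points of the plane. -/
noncomputable def exampleSet : Finset Plane :=
  exampleList.toFinset.map ⟨latticePoint, latticePoint_injective⟩

theorem card_exampleSet : exampleSet.card = 17 := by
  rw [exampleSet, Finset.card_map]; decide

theorem latticePoint_mem_exampleSet {z : ℤ × ℤ} :
    latticePoint z ∈ exampleSet ↔ z ∈ exampleList := by
  simp [exampleSet]

theorem exists_latticePoint_eq (v : exampleSet) : ∃ z ∈ exampleList, latticePoint z = v := by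
  obtain ⟨v, hv⟩ := v
  simpa [exampleSet] using hv

theorem exists_walk_exampleSet : ∃ (v : exampleSet) (c : (⊤ : SimpleGraph exampleSet).Walk v v),
    c.IsHamiltonianCycle ∧ ∀ d ∈ c.darts, delta d.fst d.snd ≤ 100 := by
  set g : {z // z ∈ exampleList} → exampleSet := fun z =>
    ⟨latticePoint z, latticePoint_mem_exampleSet.2 z.2⟩
  have hT : IsTour (g ⟨(0, 0), by decide⟩) (g ⟨(50, 50), by decide⟩) (exampleList.attach.map g) := by
    refine ⟨List.Nodup.map (fun z w h => ?_) (List.nodup_attach.2 (by decide)), fun v => ?_, rfl, rfl⟩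
    · exact Subtype.ext (latticePoint_injective (congrArg Subtype.val h))
    · obtain ⟨z, hz, e⟩ := exists_latticePoint_eq v
      exact List.mem_map.2 ⟨⟨z, hz⟩, List.mem_attach _ _, Subtype.ext e⟩
  obtain ⟨c, hc, hcT⟩ := hT.exists_walk (by
    rw [List.length_map, List.length_attach]; decide)
  refine ⟨_, c, hc, fun d hd => ?_⟩
  have hchain : c.support.IsChain fun p q : exampleSet => delta p q ≤ 100 := by
    -- `exampleList` ends with `(0, 0)`, so repeating that point in front closes the cycle.
    have h : (((0, 0) : ℤ × ℤ) :: exampleList).IsChain fun z w => latticeDelta z w ≤ 100 := by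
      decide
    have e : c.support.map Subtype.val = (((0, 0) : ℤ × ℤ) :: exampleList).map latticePoint := by
      rw [hcT]; rfl
    refine (List.isChain_map (R := fun p q => delta p q ≤ 100) Subtype.val).1 ?_
    rw [e, List.isChain_map]
    refine h.imp fun z w h => ?_
    rw [delta_latticePoint]
    exact_mod_cast h
  obtain ⟨X, Y, e⟩ := exists_append_of_mem_darts hd
  rw [e] at hchain
  exact (List.isChain_append.1 hchain).2.1.rel

/-- Only `(0, 0)` and `(50, 50)` meet the hypotheses. Their triangle is `0 < x`, `0 < y`, `x + y <
100` in lattice coordinates, which contains `exampleInner`. -/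
theorem six_le_ncard_interior {z w : ℤ × ℤ} (hz : z ∈ exampleFar) (hw : w ∈ exampleFar)
    (hne : z ≠ w) (h : latticeDelta z w ≤ 100) :
    6 ≤ ((exampleSet : Set Plane) ∩ interior (t (latticePoint z) (latticePoint w))).ncard := by
  have key : ∀ z ∈ exampleFar, ∀ w ∈ exampleFar, z ≠ w → latticeDelta z w ≤ 100 →
      ∀ x ∈ exampleInner, ∀ i, latticeSide i x < max (latticeSide i z) (latticeSide i w) := by
    decide
  have hsub : ((exampleInner.map ⟨latticePoint, latticePoint_injective⟩ : Finset Plane) :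
      Set Plane) ⊆
      ((exampleSet : Set Plane) ∩ interior (t (latticePoint z) (latticePoint w))) := by
    intro y hy
    obtain ⟨x, hx, rfl⟩ := Finset.mem_map.1 (Finset.mem_coe.1 hy)
    exact ⟨latticePoint_mem_exampleSet.2 ((by decide : ∀ x ∈ exampleInner, x ∈ exampleList) x hx),
      latticePoint_mem_interior_t (key z hz w hw hne h x hx)⟩
  have := Set.ncard_le_ncard hsub (exampleSet.finite_toSet.subset Set.inter_subset_left)
  rw [Set.ncard_coe_finset, Finset.card_map] at this
  exact this

theorem not_containsBottleneckHamiltonianCycle_kTD_five :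
    ¬ ContainsBottleneckHamiltonianCycle (kTD 5 exampleSet) := by
  classical
  rintro ⟨v, c, ⟨hc, hmin⟩, he⟩
  obtain ⟨v₀, c₀, hc₀, hle⟩ := exists_walk_exampleSet
  have h100 : delta (latticePoint (0, 0)) (latticePoint (50, 50)) = 100 := by
    rw [delta_latticePoint]
    exact_mod_cast (by decide : latticeDelta (0, 0) (50, 50) = 100)
  have hdelta : ∀ d ∈ c.darts, delta d.fst d.snd ≤ 100 := by
    intro d hd
    rw [← h100, ← weight_le_weight_iff]
    refine (weight_le_bottleneck hd).trans ((hmin v₀ c₀ hc₀).trans ?_)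
    refine bottleneck_le_iff.2 fun d hd => weight_le_weight_iff.2 ?_
    rw [h100]
    exact hle d hd
  let p : exampleSet → Bool := fun v => decide (∃ z ∈ exampleFar, latticePoint z = v)
  -- An edge between two of the nine far points has distance at most 100, hence six points inside
  -- its triangle, too many for `5-TD`.
  have hp : ∀ d ∈ c.darts, p d.fst → ¬ p d.snd := by
    intro d hd h1 h2
    obtain ⟨z, hz, hz'⟩ := of_decide_eq_true h1
    obtain ⟨w, hw, hw'⟩ := of_decide_eq_true h2
    have hadj : (kTD 5 exampleSet).Adj d.fst d.snd := he _ (List.mem_map_of_mem hd)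
    have hlt := hdelta d hd
    have hcard := hadj.2
    rw [← hz', ← hw', delta_latticePoint] at hlt
    rw [← hz', ← hw'] at hcard
    have := six_le_ncard_interior hz hw
      (fun e => hadj.1 (Subtype.ext (by rw [← hz', ← hw', e]))) (by exact_mod_cast hlt)
    omega
  -- The nine far points would be pairwise non-consecutive on a cycle of length 17, but `2 * 9 >
  -- 17`.
  have hcount := two_mul_countP_le p hp
  have hn := nodup_support_tail hc
  rw [hc.length_eq, Fintype.card_coe, card_exampleSet, List.countP_eq_length_filter] at hcount
  have hsub : exampleFar.map ⟨latticePoint, latticePoint_injective⟩ ⊆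
      (c.support.tail.filter p).toFinset.map (Function.Embedding.subtype _) := by
    intro x hx
    obtain ⟨z, hz, rfl⟩ := Finset.mem_map.1 hx
    have hz' := latticePoint_mem_exampleSet.2
      ((by decide : ∀ z ∈ exampleFar, z ∈ exampleList) z hz)
    refine Finset.mem_map.2 ⟨⟨latticePoint z, hz'⟩, ?_, rfl⟩
    rw [List.mem_toFinset, List.mem_filter]
    exact ⟨hn.2 _, decide_eq_true ⟨z, hz, rfl⟩⟩
  have h9 := Finset.card_le_card hsub
  rw [Finset.card_map, Finset.card_map] at h9
  have h9' : exampleFar.card = 9 := by decide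
  have := (c.support.tail.filter p).toFinset_card_le
  omega

end LowerBound

end TDDelaunay

theorem mainTheorem1 :
    (∀ P : Finset TDDelaunay.Plane, 3 ≤ P.card →
      TDDelaunay.ContainsBottleneckHamiltonianCycle (TDDelaunay.kTD 7 P)) ∧
    (∀ P : Finset TDDelaunay.Plane, 3 ≤ P.card → (TDDelaunay.kTD 7 P).IsHamiltonian) ∧
    (∃ P : Finset TDDelaunay.Plane, P.card = 17 ∧
      ¬ TDDelaunay.ContainsBottleneckHamiltonianCycle (TDDelaunay.kTD 5 P)) :=
  ⟨fun _ hP => TDDelaunay.containsBottleneckHamiltonianCycle_kTD_seven hP,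
    fun _ hP => TDDelaunay.isHamiltonian_of_containsBottleneckHamiltonianCycle
      (TDDelaunay.containsBottleneckHamiltonianCycle_kTD_seven hP),
    TDDelaunay.exampleSet, TDDelaunay.card_exampleSet,
    TDDelaunay.not_containsBottleneckHamiltonianCycle_kTD_five⟩
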